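/- Let $X$ be a Banach space over $\mathbb F\in\{\mathbb R,\mathbb C\}$, canonically embedded in its bidual $X^{**}$. For nonempty subsets $A,B$ of $X^{**}$ let $\operatorname{dist}(A,B)=\inf\{\|a-b\|:a\in A,\,b\in B\}$ and $\widehat{\operatorname d}(A,B)=\sup_{a\in A}\inf_{b\in B}\|a-b\|$. For a bounded sequence $(x_n)$ in $X$ let $\operatorname{clu}(x_n)$ be the set of all its cluster points in $(X^{**},w^*)$, and set $$\delta(x_n)=\sup_{x^*\in B_{X^*}}\ \inf_{n}\ \operatorname{diam}\{x^*(x_k):k\ge n\},\qquad \widetilde\delta(x_n)=\inf\{\delta(x_{n_k}):(n_k)\text{ strictly increasing}\}.$$ For a bounded set $A\subset X$ set $$\operatorname{wck}(A)=\sup\{\operatorname{dist}(\operatorname{clu}(x_n),X):(x_n)\text{ a sequence in }A\},\qquad \beta_w(A)=\sup\{\widetilde\delta(x_n):(x_n)\text{ a sequence in }A\}.$$ Given $c>0$, consider the following conditions: * $(i_c)$ $\widehat{\operatorname d}(\operatorname{clu}(x_n),X)\le c\,\delta(x_n)$ for each bounded sequence $(x_n)$ in $X$; * $(ii_c)$ $\operatorname{dist}(\operatorname{clu}(x_n),X)\le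 c\,\delta(x_n)$ for each bounded sequence $(x_n)$ in $X$; * $(iii_c)$ $\operatorname{dist}(\operatorname{clu}(x_n),X)\le c\,\widetilde\delta(x_n)$ for each bounded sequence $(x_n)$ in $X$; * $(iv_c)$ $\operatorname{wck}(A)\le c\,\beta_w(A)$ for each bounded set $A\subset X$. Then the following hold. 1. For each $c>0$: $(i_c)\Rightarrow(ii_c)\Leftrightarrow(iii_c)\Leftrightarrow(iv_c)\Rightarrow(i_{2c})$. 2. The quantities $\operatorname{wck}$ and $\beta_w$ are equivalent in $X$ (that is, there are constants $a,b>0$ such that $\operatorname{wck}(A)\le a\,\beta_w(A)$ and $\beta_w(A)\le b\,\operatorname{wck}(A)$ for all bounded $A\subset X$) if and only if $X$ is quantitatively weakly sequentially complete (that is, for some $c\ge0$ the inequality in $(i_c)$ holds for each bounded sequence in $X$). 3. If $X$ is $L$-embedded (that is, there is a linear projection $P$ of $X^{**}$ onto $X$ with $\|z\|=\|Pz\|+\|z-Pz\|$ for all $z\in X^{**}$), then $\beta_w(A)=2\operatorname{wck}(A)$ for each bounded set $A\subset X$. -/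

import Mathlib

set_option maxSynthPendingDepth 3

open scoped NNReal ENNReal Topology

namespace QuantWSC

section MetricQuantities

variable {E : Type*} [PseudoEMetricSpace E]

/-- The excess `sup {dist(a, B) : a ∈ A}` of `A` from `B`. -/
noncomputable def excess (A B : Set E) : ℝ≥0∞ :=
  ⨆ a ∈ A, Metric.infEDist a B

/-- The distance `inf {dist(a, b) : a ∈ A, b ∈ B}` of two sets. -/
noncomputable def setDist (A B : Set E) : ℝ≥0∞ :=
  ⨅ a ∈ A, Metric.infEDist a B

/-- The oscillation `inf_n diam {u k : k ≥ n}` of a sequence. -/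
noncomputable def ca (u : ℕ → E) : ℝ≥0∞ :=
  ⨅ n : ℕ, Metric.ediam (u '' Set.Ici n)

end MetricQuantities

section BanachSpace

variable (𝕜 : Type*) [RCLike 𝕜] {X : Type*} [NormedAddCommGroup X] [NormedSpace 𝕜 X]

/-- The bidual of `X`, with its norm. -/
abbrev Bidual (𝕜 : Type*) [RCLike 𝕜] (X : Type*) [NormedAddCommGroup X] [NormedSpace 𝕜 X] :
    Type _ :=
  StrongDual 𝕜 (StrongDual 𝕜 X)

/-- `X` as a subset of its bidual. -/
def canonicalImage (𝕜 : Type*) [RCLike 𝕜] (X : Type*) [NormedAddCommGroup X] [NormedSpace 𝕜 X] :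
    Set (Bidual 𝕜 X) :=
  Set.range (NormedSpace.inclusionInDoubleDual 𝕜 X)

/-- The set of all cluster points of the sequence `x` in the bidual with its weak* topology. -/
def clu (x : ℕ → X) : Set (Bidual 𝕜 X) :=
  {z | MapClusterPt (StrongDual.toWeakDual z) Filter.atTop
    (fun n => StrongDual.toWeakDual (NormedSpace.inclusionInDoubleDual 𝕜 X (x n)))}

/-- `δ(x) = sup {ca (f (x n)) : f in the closed unit ball of the dual}`. -/
noncomputable def delta (x : ℕ → X) : ℝ≥0∞ :=
  ⨆ f ∈ Metric.closedBall (0 : StrongDual 𝕜 X) 1, ca (fun n => f (x n))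

/-- `δ̃(x)`, the infimum of `δ` over all subsequences. -/
noncomputable def deltaTilde (x : ℕ → X) : ℝ≥0∞ :=
  ⨅ (φ : ℕ → ℕ) (_ : StrictMono φ), delta 𝕜 (x ∘ φ)

/-- `wck(A) = sup {dist(clu(x), X) : x a sequence in A}`. -/
noncomputable def wck (A : Set X) : ℝ≥0∞ :=
  ⨆ (x : ℕ → X) (_ : ∀ n, x n ∈ A), setDist (clu 𝕜 x) (canonicalImage 𝕜 X)

/-- `β_w(A) = sup {δ̃(x) : x a sequence in A}`. -/
noncomputable def betaW (A : Set X) : ℝ≥0∞ :=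
  ⨆ (x : ℕ → X) (_ : ∀ n, x n ∈ A), deltaTilde 𝕜 x

/-- Condition (i): `X` is `c`-weakly sequentially complete. -/
def CondI (𝕜 : Type*) [RCLike 𝕜] (X : Type*) [NormedAddCommGroup X] [NormedSpace 𝕜 X]
    (c : ℝ≥0) : Prop :=
  ∀ x : ℕ → X, Bornology.IsBounded (Set.range x) →
    excess (clu 𝕜 x) (canonicalImage 𝕜 X) ≤ (c : ℝ≥0∞) * delta 𝕜 x

/-- Condition (ii). -/
def CondII (𝕜 : Type*) [RCLike 𝕜] (X : Type*) [NormedAddCommGroup X] [NormedSpace 𝕜 X]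
    (c : ℝ≥0) : Prop :=
  ∀ x : ℕ → X, Bornology.IsBounded (Set.range x) →
    setDist (clu 𝕜 x) (canonicalImage 𝕜 X) ≤ (c : ℝ≥0∞) * delta 𝕜 x

/-- Condition (iii). -/
def CondIII (𝕜 : Type*) [RCLike 𝕜] (X : Type*) [NormedAddCommGroup X] [NormedSpace 𝕜 X]
    (c : ℝ≥0) : Prop :=
  ∀ x : ℕ → X, Bornology.IsBounded (Set.range x) →
    setDist (clu 𝕜 x) (canonicalImage 𝕜 X) ≤ (c : ℝ≥0∞) * deltaTilde 𝕜 x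

/-- Condition (iv). -/
def CondIV (𝕜 : Type*) [RCLike 𝕜] (X : Type*) [NormedAddCommGroup X] [NormedSpace 𝕜 X]
    (c : ℝ≥0) : Prop :=
  ∀ A : Set X, Bornology.IsBounded A → wck 𝕜 A ≤ (c : ℝ≥0∞) * betaW 𝕜 A

/-- The quantities `wck` and `β_w` are equivalent in `X`: each is bounded by a constant multiple
of the other, on all bounded sets. -/
def WckEquivBetaW (𝕜 : Type*) [RCLike 𝕜] (X : Type*) [NormedAddCommGroup X]
    [NormedSpace 𝕜 X] : Prop :=
  ∃ a b : ℝ≥0, 0 < a ∧ 0 < b ∧ ∀ A : Set X, Bornology.IsBounded A →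
    wck 𝕜 A ≤ (a : ℝ≥0∞) * betaW 𝕜 A ∧ betaW 𝕜 A ≤ (b : ℝ≥0∞) * wck 𝕜 A

/-- `X` is quantitatively weakly sequentially complete: `c`-weakly sequentially complete
for some `c ≥ 0`. -/
def QuantitativelyWSC (𝕜 : Type*) [RCLike 𝕜] (X : Type*) [NormedAddCommGroup X]
    [NormedSpace 𝕜 X] : Prop :=
  ∃ c : ℝ≥0, CondI 𝕜 X c

/-- `X` is `L`-embedded: it is the range of a projection `P` on its bidual that satisfies
`‖z‖ = ‖P z‖ + ‖z - P z‖`. -/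
def LEmbedded (𝕜 : Type*) [RCLike 𝕜] (X : Type*) [NormedAddCommGroup X] [NormedSpace 𝕜 X] :
    Prop :=
  ∃ P : Bidual 𝕜 X →L[𝕜] Bidual 𝕜 X,
    IsLprojection (Bidual 𝕜 X) P ∧ Set.range P = canonicalImage 𝕜 X

end BanachSpace

end QuantWSC

open Filter

namespace QuantWSC

/-! ### Weak* compactness, Goldstine's theorem and Hahn–Banach separation. -/

section Functionals

variable {𝕜 : Type*} [RCLike 𝕜] {E : Type*} [NormedAddCommGroup E] [NormedSpace 𝕜 E]

/-! The equivalence of (ii), (iii) and (iv) is soft: passing to a subsequence shrinks the cluster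
set, and a sequence in the range of `x` has a subsequence of oscillation at most `delta 𝕜 x`
(`betaW_range_le_delta`). Three estimates carry the rest.

Quantitative Eberlein (`excess_clu_le_two_mul_wck`), giving (iv) ⇒ (i) with constant `2 * c`: a
cluster point far from `X` yields functionals and points of the sequence whose iterated limits
differ, and every cluster point of the chosen points is at least half as far from `X`.

Quantitative Rosenthal (`betaW_le_two_mul_wck`), valid in every space: if all subsequences oscillate
by more than `d`, some sequence of terms has independent level sets with gap above `d`. Projecting
the dual ball onto the Cantor space and taking a minimal closed set that still surjects shows that
its cluster points are at distance at least `d / 2` from `X`.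

`L`-embedded spaces (`condI_half_of_lEmbedded`): the singular part `z - P z` of a cluster point can
be given values of either sign without disturbing values at finitely many points of `X`. A weak*
limit then oscillates by at least twice any number below `‖z - P z‖`. This gives (i) with constant
1/2, hence the reverse inequality in the third claim. -/

theorem exists_re_gt_of_lt_norm {w : StrongDual 𝕜 E} {u : ℝ} (hu : u < ‖w‖) :
    ∃ e : E, ‖e‖ ≤ 1 ∧ u < RCLike.re (w e) := by
  obtain hu0 | hu0 := lt_or_ge u 0
  · exact ⟨0, by simp, by simpa using hu0⟩
  obtain ⟨e, he, hlt⟩ := w.exists_lt_apply_of_lt_opNorm hu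
  obtain ⟨c, hc, hce⟩ := RCLike.exists_norm_eq_mul_self (w e)
  refine ⟨c • e, by rw [norm_smul, hc, one_mul]; exact he.le, ?_⟩
  rw [map_smul, smul_eq_mul, ← hce, RCLike.ofReal_re]
  exact hlt

/-- Limits along an ultrafilter exist in the weak* topology for bounded families of functionals. -/
theorem exists_ultrafilter_limit {ι : Type*} (U : Ultrafilter ι) (f : ι → StrongDual 𝕜 E)
    {C : ℝ} (hf : ∀ i, ‖f i‖ ≤ C) :
    ∃ g : StrongDual 𝕜 E, ‖g‖ ≤ C ∧ ∀ e, Tendsto (fun i => f i e) U (𝓝 (g e)) := by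
  have hK := WeakDual.isCompact_closedBall (𝕜 := 𝕜) (0 : StrongDual 𝕜 E) C
  obtain ⟨g, hg, hle⟩ := hK.ultrafilter_le_nhds
    (U.map (fun i => StrongDual.toWeakDual (f i))) (by
      rw [le_principal_iff]
      refine Eventually.of_forall (f := (U : Filter ι)) (fun i => ?_)
      simpa using hf i)
  refine ⟨WeakDual.toStrongDual g, by simpa using hg, fun e => ?_⟩
  exact ((WeakDual.eval_continuous e).tendsto g).comp hle

/-- Helly's argument: were the values of `Φ` on `S` outside the closed convex image of the ball, the
separating functional would pull back to a combination of members of `S` on which `Φ` exceeds the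
norm. -/
theorem exists_unit_near_bidual_on_finset (Φ : StrongDual 𝕜 (StrongDual 𝕜 E)) (hΦ : ‖Φ‖ ≤ 1)
    (S : Finset (StrongDual 𝕜 E)) {ε : ℝ} (hε : 0 < ε) :
    ∃ e : E, ‖e‖ ≤ 1 ∧ ∀ s ∈ S, dist (s e) (Φ s) < ε := by
  classical
  let T : E →L[𝕜] (S → 𝕜) := ContinuousLinearMap.pi fun s => s.1
  let v : S → 𝕜 := fun s => Φ s.1
  have hconv : Convex ℝ (T '' Metric.closedBall 0 1) := by
    rintro _ ⟨x, hx, rfl⟩ _ ⟨y, hy, rfl⟩ a b ha hb hab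
    refine ⟨(a : 𝕜) • x + (b : 𝕜) • y, ?_, ?_⟩
    · rw [mem_closedBall_zero_iff] at hx hy ⊢
      calc ‖(a : 𝕜) • x + (b : 𝕜) • y‖ ≤ a * ‖x‖ + b * ‖y‖ := by
            refine (norm_add_le _ _).trans_eq ?_
            simp [norm_smul, abs_of_nonneg ha, abs_of_nonneg hb]
        _ ≤ a * 1 + b * 1 := by gcongr
        _ = 1 := by linarith
    · ext s
      simp [T, RCLike.real_smul_eq_coe_mul]
  have hv : v ∈ closure (T '' Metric.closedBall 0 1) := by
    by_contra hv
    obtain ⟨g, u, hgu, hug⟩ := RCLike.geometric_hahn_banach_closed_point (𝕜 := 𝕜)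
      hconv.closure isClosed_closure hv
    have hw : ‖g ∘L T‖ ≤ u := by
      by_contra! hlt
      obtain ⟨e, he, hue⟩ := exists_re_gt_of_lt_norm hlt
      exact (hue.trans (hgu _ (subset_closure ⟨e, by simpa using he, rfl⟩))).false
    have hcomb : g ∘L T = ∑ s : S, g (fun j => if s = j then 1 else 0) • s.1 := by
      ext e
      have := LinearMap.pi_apply_eq_sum_univ (g : (S → 𝕜) →ₗ[𝕜] 𝕜) (T e)
      simp only [ContinuousLinearMap.coe_coe] at this
      simp only [ContinuousLinearMap.comp_apply, this, sum_apply,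
        smul_apply]
      refine Finset.sum_congr rfl fun s _ => ?_
      rw [smul_eq_mul, smul_eq_mul, mul_comm]
      rfl
    have hgv : g v = Φ (g ∘L T) := by
      have := LinearMap.pi_apply_eq_sum_univ (g : (S → 𝕜) →ₗ[𝕜] 𝕜) v
      simp only [ContinuousLinearMap.coe_coe] at this
      rw [this, hcomb, map_sum]
      refine Finset.sum_congr rfl fun s _ => ?_
      rw [map_smul, smul_eq_mul, smul_eq_mul, mul_comm]
    have : RCLike.re (g v) ≤ u := by
      rw [hgv]
      calc RCLike.re (Φ (g ∘L T)) ≤ ‖Φ (g ∘L T)‖ := RCLike.re_le_norm _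
        _ ≤ ‖Φ‖ * ‖g ∘L T‖ := Φ.le_opNorm _
        _ ≤ 1 * ‖g ∘L T‖ := by gcongr
        _ ≤ u := by rw [one_mul]; exact hw
    exact (hug.trans_le this).false
  obtain ⟨_, ⟨e, he, rfl⟩, hlt⟩ := Metric.mem_closure_iff.1 hv ε hε
  refine ⟨e, by simpa using he, fun s hs => ?_⟩
  rw [dist_comm]
  exact (dist_le_pi_dist v (T e) ⟨s, hs⟩).trans_lt hlt

/-- Goldstine's theorem: an element of the unit ball of the bidual is a weak* limit, along some
filter, of elements of the unit ball. -/
theorem exists_filter_tendsto_bidual (Φ : StrongDual 𝕜 (StrongDual 𝕜 E)) (hΦ : ‖Φ‖ ≤ 1) :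
    ∃ l : Filter E, l.NeBot ∧ (∀ᶠ e in l, ‖e‖ ≤ 1) ∧
      ∀ s : StrongDual 𝕜 E, Tendsto (fun e => s e) l (𝓝 (Φ s)) := by
  classical
  choose e he hes using fun p : Finset (StrongDual 𝕜 E) × ℕ =>
    exists_unit_near_bidual_on_finset Φ hΦ p.1 (Nat.one_div_pos_of_nat (α := ℝ) (n := p.2))
  refine ⟨map e atTop, inferInstance, eventually_map.2 (Eventually.of_forall he), fun s => ?_⟩
  rw [tendsto_map'_iff, Metric.tendsto_nhds]
  intro ε hε
  obtain ⟨N, hN⟩ := exists_nat_one_div_lt hε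
  filter_upwards [eventually_ge_atTop (({s} : Finset (StrongDual 𝕜 E)), N)] with p hp
  exact (hes p s (hp.1 (Finset.mem_singleton_self s))).trans
    ((Nat.one_div_le_one_div hp.2).trans_lt hN)

theorem norm_inclusionInDoubleDual (p : E) :
    ‖NormedSpace.inclusionInDoubleDual 𝕜 E p‖ = ‖p‖ :=
  (NormedSpace.inclusionInDoubleDualLi (E := E) 𝕜).norm_map p

/-- A point is separated from a subspace by a functional that attains the distance. -/
theorem exists_dual_eq_infDist (F : Submodule 𝕜 E) [IsClosed (F : Set E)] (z : E) :
    ∃ Φ : StrongDual 𝕜 E, ‖Φ‖ ≤ 1 ∧ (∀ p ∈ F, Φ p = 0) ∧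
      Φ z = ((Metric.infDist z (F : Set E) : ℝ) : 𝕜) := by
  obtain ⟨g, hg, hgz⟩ := exists_dual_vector'' 𝕜 (Submodule.Quotient.mk z : E ⧸ F)
  refine ⟨g ∘L F.mkQL, ?_, fun p hp => ?_, ?_⟩
  · refine ContinuousLinearMap.opNorm_le_bound _ zero_le_one fun e => ?_
    refine (g.le_of_opNorm_le hg _).trans ?_
    gcongr
    exact Submodule.Quotient.norm_mk_le F e
  · have : (Submodule.Quotient.mk p : E ⧸ F) = 0 := (Submodule.Quotient.mk_eq_zero F).2 hp
    simp [this]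
  · rw [ContinuousLinearMap.comp_apply, Submodule.mkQL_apply, Submodule.mkQ_apply, hgz]
    congr 1
    exact QuotientAddGroup.norm_mk z

end Functionals

/-! ### Cluster points, subsequences and oscillation. -/

section Basics

variable {𝕜 : Type*} [RCLike 𝕜] {X : Type*} [NormedAddCommGroup X] [NormedSpace 𝕜 X]

theorem mem_clu_iff {x : ℕ → X} {z : Bidual 𝕜 X} :
    z ∈ clu 𝕜 x ↔ ∃ U : Ultrafilter ℕ, (U : Filter ℕ) ≤ atTop ∧
      ∀ f : StrongDual 𝕜 X, Tendsto (fun n => f (x n)) U (𝓝 (z f)) := by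
  rw [clu, Set.mem_ofPred_eq, mapClusterPt_iff_ultrafilter]
  refine exists_congr fun U => and_congr_right fun _ => ?_
  exact tendsto_iff_forall_eval_tendsto_topDualPairing

theorem clu_comp_subset {x : ℕ → X} {φ : ℕ → ℕ} (hφ : StrictMono φ) :
    clu 𝕜 (x ∘ φ) ⊆ clu 𝕜 x := fun z hz => by
  rw [clu, Set.mem_ofPred_eq] at hz ⊢
  exact MapClusterPt.of_comp (φ := φ) (p := atTop) hφ.tendsto_atTop hz

/-- Needed for (i) ⇒ (ii): on an empty set `setDist` is `⊤` while `excess` is 0. -/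
theorem clu_nonempty {x : ℕ → X} (hx : Bornology.IsBounded (Set.range x)) :
    (clu 𝕜 x).Nonempty := by
  obtain ⟨C, hC⟩ := isBounded_iff_forall_norm_le.1 hx
  obtain ⟨z, -, hz⟩ := exists_ultrafilter_limit (Ultrafilter.of atTop)
    (fun n => NormedSpace.inclusionInDoubleDual 𝕜 X (x n)) (C := C)
    (fun n => (norm_inclusionInDoubleDual _).trans_le (hC _ ⟨n, rfl⟩))
  exact ⟨z, mem_clu_iff.2 ⟨_, Ultrafilter.of_le _, hz⟩⟩

theorem setDist_anti {E : Type*} [PseudoEMetricSpace E] {A A' B : Set E} (h : A ⊆ A') :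
    setDist A' B ≤ setDist A B :=
  iInf_le_iInf_of_subset h

theorem setDist_le_excess {E : Type*} [PseudoEMetricSpace E] {A B : Set E} (hA : A.Nonempty) :
    setDist A B ≤ excess A B := by
  obtain ⟨a, ha⟩ := hA
  exact (iInf₂_le a ha).trans (le_iSup₂ (f := fun a _ => Metric.infEDist a B) a ha)

theorem ofReal_le_setDist {A : Set (Bidual 𝕜 X)} {r : ℝ}
    (h : ∀ w ∈ A, ∀ p : X, r ≤ ‖w - NormedSpace.inclusionInDoubleDual 𝕜 X p‖) :
    ENNReal.ofReal r ≤ setDist A (canonicalImage 𝕜 X) := by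
  refine le_iInf₂ fun w hw => Metric.le_infEDist.2 ?_
  rintro _ ⟨p, rfl⟩
  rw [edist_dist, dist_eq_norm]
  exact ENNReal.ofReal_le_ofReal (h w hw p)

theorem ca_comp_le {E : Type*} [PseudoEMetricSpace E] (u : ℕ → E) {φ : ℕ → ℕ}
    (hφ : StrictMono φ) : ca (u ∘ φ) ≤ ca u :=
  iInf_mono fun n => Metric.ediam_mono <| by
    rintro _ ⟨k, hk, rfl⟩
    exact ⟨φ k, (Set.mem_Ici.1 hk).trans (hφ.id_le k), rfl⟩

theorem delta_comp_le (x : ℕ → X) {φ : ℕ → ℕ} (hφ : StrictMono φ) :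
    delta 𝕜 (x ∘ φ) ≤ delta 𝕜 x :=
  iSup₂_mono fun f _ => ca_comp_le (fun n => f (x n)) hφ

theorem deltaTilde_le_delta_comp (x : ℕ → X) {φ : ℕ → ℕ} (hφ : StrictMono φ) :
    deltaTilde 𝕜 x ≤ delta 𝕜 (x ∘ φ) :=
  iInf₂_le φ hφ

theorem deltaTilde_le_delta (x : ℕ → X) : deltaTilde 𝕜 x ≤ delta 𝕜 x :=
  deltaTilde_le_delta_comp x strictMono_id

theorem delta_eq_zero_of_eventually_const {x : ℕ → X} {N : ℕ} (h : ∀ n ≥ N, x n = x N) :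
    delta 𝕜 x = 0 := by
  refine le_antisymm (iSup₂_le fun f _ => (iInf_le _ N).trans ?_) (zero_le)
  refine (Metric.ediam_subsingleton ?_).le
  rintro _ ⟨k, hk, rfl⟩ _ ⟨l, hl, rfl⟩
  simp only [h k hk, h l hl]

/-- A sequence in the range of `x` has a subsequence that is constant or a subsequence of `x`. -/
theorem betaW_range_le_delta (x : ℕ → X) : betaW 𝕜 (Set.range x) ≤ delta 𝕜 x := by
  refine iSup₂_le fun y hy => ?_
  choose m hm using hy
  obtain rfl : x ∘ m = y := funext hm
  -- In the nonincreasing case the indices stabilise by well-foundedness of `ℕ`, so the oscillation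
  -- is 0.
  obtain ⟨g, hg⟩ := exists_increasing_or_nonincreasing_subseq (· < ·) m
  refine (deltaTilde_le_delta_comp _ g.strictMono).trans ?_
  obtain hg | hg := hg
  · exact delta_comp_le x (φ := m ∘ g) (fun a b hab => hg a b hab)
  · obtain ⟨N, hN⟩ : ∃ N, ∀ n, m (g N) ≤ m (g n) :=
      ⟨Function.argmin (m ∘ g), fun n => Function.argmin_le (m ∘ g) n⟩
    rw [delta_eq_zero_of_eventually_const (N := N)]
    · exact zero_le
    · intro n hn
      obtain rfl | hlt := hn.eq_or_lt
      · rfl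
      · simp only [Function.comp_apply]
        rw [le_antisymm (not_lt.1 (hg N n hlt)) (hN n)]

/-- Oscillation of a bounded sequence is witnessed by the real part of a single functional. -/
theorem exists_re_oscillation {x : ℕ → X} (hx : Bornology.IsBounded (Set.range x)) {d : ℝ≥0}
    (hd : d < delta 𝕜 x) :
    ∃ f : StrongDual 𝕜 X, ‖f‖ ≤ 1 ∧ ∃ a b : ℚ, (d : ℝ) < b - a ∧
      (∃ᶠ n in atTop, RCLike.re (f (x n)) ≤ a) ∧ ∃ᶠ n in atTop, (b : ℝ) ≤ RCLike.re (f (x n)) := by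
  obtain ⟨C, hC⟩ := isBounded_iff_forall_norm_le.1 hx
  obtain ⟨f, hf⟩ := lt_iSup_iff.1 hd
  obtain ⟨hf1, hf⟩ := lt_iSup_iff.1 hf
  rw [mem_closedBall_zero_iff] at hf1
  obtain ⟨d', hdd', hd'⟩ := ENNReal.lt_iff_exists_nnreal_btwn.1 hf
  have hdd'' : (d : ℝ) < d' := by exact_mod_cast hdd'
  have key : ∀ N, ∃ k l, N ≤ k ∧ N ≤ l ∧ (d' : ℝ) ≤ dist (f (x k)) (f (x l)) := by
    intro N
    by_contra! h
    refine (hd'.trans_le (iInf_le _ N)).not_ge (Metric.ediam_le ?_)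
    rintro _ ⟨k, hk, rfl⟩ _ ⟨l, hl, rfl⟩
    rw [edist_nndist, ENNReal.coe_le_coe]
    exact_mod_cast (h k l hk hl).le
  choose k l hk hl hkl using key
  let U : Ultrafilter ℕ := Ultrafilter.of atTop
  have hU : (U : Filter ℕ) ≤ atTop := Ultrafilter.of_le _
  have lim : ∀ φ : ℕ → ℕ, ∃ c, Tendsto (fun n => f (x (φ n))) U (𝓝 c) := by
    intro φ
    obtain ⟨c, -, hc⟩ := (isCompact_closedBall (0 : 𝕜) C).ultrafilter_le_nhds
      (U.map fun n => f (x (φ n))) (by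
        rw [le_principal_iff]
        refine Eventually.of_forall (f := (U : Filter ℕ)) fun n => ?_
        rw [mem_closedBall_zero_iff]
        refine (f.le_of_opNorm_le hf1 _).trans ?_
        rw [one_mul]
        exact hC _ ⟨_, rfl⟩)
    exact ⟨c, hc⟩
  obtain ⟨c₁, h₁⟩ := lim k
  obtain ⟨c₂, h₂⟩ := lim l
  have hc : (d' : ℝ) ≤ ‖c₁ - c₂‖ := by
    rw [← dist_eq_norm]
    exact ge_of_tendsto' (h₁.dist h₂) hkl
  -- Rotating `f` by `c` makes the gap of the two limits real. The rationals `a`, `b` each give up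
  -- less than `(d' - d) / 2` of it, leaving more than `d`.
  obtain ⟨c, hc1, hcc⟩ := RCLike.exists_norm_eq_mul_self (c₁ - c₂)
  have hre : ‖c₁ - c₂‖ = RCLike.re (c * c₁) - RCLike.re (c * c₂) := by
    rw [← map_sub, ← mul_sub, ← hcc, RCLike.ofReal_re]
  obtain ⟨a, ha, ha'⟩ := exists_rat_btwn
    (show RCLike.re (c * c₂) < RCLike.re (c * c₂) + (d' - d) / 2 by linarith)
  obtain ⟨b, hb, hb'⟩ := exists_rat_btwn
    (show RCLike.re (c * c₁) - (d' - d) / 2 < RCLike.re (c * c₁) by linarith)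
  have hre' : ∀ {φ : ℕ → ℕ} {e : 𝕜}, Tendsto (fun n => f (x (φ n))) U (𝓝 e) →
      Tendsto (fun n => RCLike.re ((c • f) (x (φ n)))) U (𝓝 (RCLike.re (c * e))) := by
    intro φ e h
    exact (RCLike.continuous_re.tendsto _).comp (h.const_mul c)
  have hfreq : ∀ {φ : ℕ → ℕ} {p : ℕ → Prop}, (∀ n, n ≤ φ n) → (∀ᶠ n in (U : Filter ℕ), p (φ n)) →
      ∃ᶠ n in atTop, p n := by
    intro φ p hφ hp
    exact (tendsto_atTop_mono hφ tendsto_id).frequently (hp.frequently.filter_mono hU)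
  refine ⟨c • f, ?_, a, b, ?_, ?_, ?_⟩
  · rw [norm_smul, hc1, one_mul]
    exact hf1
  · linarith
  · exact hfreq hl (((hre' h₂).eventually_lt_const ha).mono fun _ h => h.le)
  · exact hfreq hk (((hre' h₁).eventually_const_lt hb').mono fun _ h => h.le)

end Basics

/-! ### The quantitative Eberlein theorem. -/

section Eberlein

variable {𝕜 : Type*} [RCLike 𝕜] {X : Type*} [NormedAddCommGroup X] [NormedSpace 𝕜 X]

theorem isClosed_canonicalImage [CompleteSpace X] : IsClosed (canonicalImage 𝕜 X) :=
  (NormedSpace.inclusionInDoubleDualLi (E := X) 𝕜).isometry.isClosedEmbedding.isClosed_range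

/-- A simultaneous choice of functionals and points of the sequence with interchanged iterated
limits, starting from a cluster point far from `X`. -/
theorem exists_interchanged_seq [CompleteSpace X] {x : ℕ → X} {z : Bidual 𝕜 X}
    (hz : z ∈ clu 𝕜 x) {r : ℝ} (hr : r < Metric.infDist z (canonicalImage 𝕜 X)) :
    ∃ (f : ℕ → StrongDual 𝕜 X) (y : ℕ → X), (∀ n, ‖f n‖ ≤ 1) ∧ (∀ n, y n ∈ Set.range x) ∧
      ∀ m n, m < n → ‖f n (y m)‖ < 1 / ((n : ℝ) + 1) ∧ r < RCLike.re (f m (y n)) := by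
  let F : Submodule 𝕜 (Bidual 𝕜 X) :=
    LinearMap.range (NormedSpace.inclusionInDoubleDual 𝕜 X : X →ₗ[𝕜] Bidual 𝕜 X)
  have hF : (F : Set (Bidual 𝕜 X)) = canonicalImage 𝕜 X := rfl
  have : IsClosed (F : Set (Bidual 𝕜 X)) := isClosed_canonicalImage
  obtain ⟨Φ, hΦ, hΦF, hΦz⟩ := exists_dual_eq_infDist F z
  rw [hF] at hΦz
  obtain ⟨l, _, hl1, hl⟩ := exists_filter_tendsto_bidual Φ hΦ
  obtain ⟨U, hU, hUz⟩ := mem_clu_iff.1 hz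
  -- The first entry of each triple is a counter; it increases strictly, so it dominates the index
  -- and turns the tolerance into `1 / (n + 1)`. Keeping `r < RCLike.re (z f)` is what lets later
  -- points of the sequence satisfy the second inequality.
  obtain ⟨s, hsP, hsR⟩ := exists_seq_of_forall_finset_exists
    (fun a : ℕ × StrongDual 𝕜 X × X =>
      ‖a.2.1‖ ≤ 1 ∧ r < RCLike.re (z a.2.1) ∧ a.2.2 ∈ Set.range x)
    (fun a b => a.1 < b.1 ∧ ‖b.2.1 a.2.2‖ < 1 / ((b.1 : ℝ) + 1) ∧ r < RCLike.re (a.2.1 b.2.2))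
    (by
      intro S hS
      let k := S.sup Prod.fst + 1
      have h1 : ∀ᶠ f in l, ∀ a ∈ S, ‖f a.2.2‖ < 1 / ((k : ℝ) + 1) := by
        refine (Finset.eventually_all S).2 fun a _ => ?_
        have h := (hl (NormedSpace.inclusionInDoubleDual 𝕜 X a.2.2)).norm
        rw [hΦF (NormedSpace.inclusionInDoubleDual 𝕜 X a.2.2) ⟨_, rfl⟩, norm_zero] at h
        exact h.eventually_lt_const Nat.one_div_pos_of_nat
      have h2 : ∀ᶠ f in l, r < RCLike.re (z f) := by
        refine ((RCLike.continuous_re.tendsto _).comp (hl z)).eventually_const_lt ?_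
        rw [hΦz, RCLike.ofReal_re]
        exact hr
      obtain ⟨f, hf, hfS, hfz⟩ := (hl1.and (h1.and h2)).exists
      have h3 : ∀ g : StrongDual 𝕜 X, r < RCLike.re (z g) →
          ∀ᶠ n in (U : Filter ℕ), r < RCLike.re (g (x n)) := fun g hg =>
        ((RCLike.continuous_re.tendsto _).comp (hUz g)).eventually_const_lt hg
      obtain ⟨n, hn⟩ := ((Finset.eventually_all S).2 fun a ha => h3 a.2.1 (hS a ha).2.1).exists
      exact ⟨(k, f, x n), ⟨hf, hfz, n, rfl⟩, fun a ha =>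
        ⟨Nat.lt_succ_of_le (Finset.le_sup (f := Prod.fst) ha), hfS a ha, hn a ha⟩⟩)
  have hmono : StrictMono fun n => (s n).1 := fun m n h => (hsR m n h).1
  refine ⟨fun n => (s n).2.1, fun n => (s n).2.2, fun n => (hsP n).1, fun n => (hsP n).2.2,
    fun m n h => ⟨(hsR m n h).2.1.trans_le (Nat.one_div_le_one_div (hmono.le_apply)),
      (hsR m n h).2.2⟩⟩

/-- A weak* limit `g` of the `f n` kills every `y m`, so `w g = 0`, whereas `w (f m)` has real part
at least `r`. Testing `w - p` on `f m - g`, of norm at most 2, gives the bound, since `f m p - g p`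
tends to 0 along the ultrafilter. -/
theorem le_two_mul_norm_sub_of_interchanged {f : ℕ → StrongDual 𝕜 X} {y : ℕ → X} {r : ℝ}
    (hf : ∀ n, ‖f n‖ ≤ 1)
    (hfy : ∀ m n, m < n → ‖f n (y m)‖ < 1 / ((n : ℝ) + 1) ∧ r < RCLike.re (f m (y n)))
    {w : Bidual 𝕜 X} (hw : w ∈ clu 𝕜 y) (p : X) :
    r ≤ 2 * ‖w - NormedSpace.inclusionInDoubleDual 𝕜 X p‖ := by
  let U : Ultrafilter ℕ := Ultrafilter.of atTop
  have hU : (U : Filter ℕ) ≤ atTop := Ultrafilter.of_le _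
  obtain ⟨g, hg, hlim⟩ := exists_ultrafilter_limit U f hf
  obtain ⟨V, hV, hVw⟩ := mem_clu_iff.1 hw
  have hgy : ∀ m, g (y m) = 0 := by
    intro m
    refine tendsto_nhds_unique (hlim (y m)) (squeeze_zero_norm' ?_
      (tendsto_one_div_add_atTop_nhds_zero_nat.mono_left hU))
    filter_upwards [hU (eventually_gt_atTop m)] with n hn
    exact (hfy m n hn).1.le
  have hwg : w g = 0 := by
    refine tendsto_nhds_unique (hVw g) ?_
    simp only [hgy]
    exact tendsto_const_nhds
  have hwf : ∀ m, r ≤ RCLike.re (w (f m)) := by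
    intro m
    refine ge_of_tendsto ((RCLike.continuous_re.tendsto _).comp (hVw (f m))) ?_
    filter_upwards [hV (eventually_gt_atTop m)] with n hn
    exact (hfy m n hn).2.le
  have hbound : ∀ m, r ≤ 2 * ‖w - NormedSpace.inclusionInDoubleDual 𝕜 X p‖ +
      (RCLike.re (f m p) - RCLike.re (g p)) := by
    intro m
    have h1 := (w - NormedSpace.inclusionInDoubleDual 𝕜 X p).le_of_opNorm_le le_rfl (f m - g)
    have h2 := (RCLike.re_le_norm _).trans h1
    have h3 : ‖f m - g‖ ≤ 2 := (norm_sub_le _ _).trans (by linarith [hf m])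
    have h4 := mul_le_mul_of_nonneg_left h3
      (norm_nonneg (w - NormedSpace.inclusionInDoubleDual 𝕜 X p))
    simp only [sub_apply, map_sub, NormedSpace.dual_def, hwg, map_zero] at h2
    linarith [hwf m]
  have hlim' : Tendsto (fun m => 2 * ‖w - NormedSpace.inclusionInDoubleDual 𝕜 X p‖ +
      (RCLike.re (f m p) - RCLike.re (g p))) U
      (𝓝 (2 * ‖w - NormedSpace.inclusionInDoubleDual 𝕜 X p‖ +
        (RCLike.re (g p) - RCLike.re (g p)))) :=
    (((RCLike.continuous_re.tendsto _).comp (hlim p)).sub_const _).const_add _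
  rw [sub_self, add_zero] at hlim'
  exact ge_of_tendsto' hlim' hbound

/-- A quantitative Eberlein theorem. -/
theorem excess_clu_le_two_mul_wck [CompleteSpace X] (x : ℕ → X) :
    excess (clu 𝕜 x) (canonicalImage 𝕜 X) ≤ 2 * wck 𝕜 (Set.range x) := by
  refine iSup₂_le fun z hz => le_of_forall_lt fun r hr => ?_
  obtain ⟨q, hrq, hq⟩ := ENNReal.lt_iff_exists_nnreal_btwn.1 hr
  have hq' : (q : ℝ) < Metric.infDist z (canonicalImage 𝕜 X) :=
    (ENNReal.toReal_lt_toReal ENNReal.coe_ne_top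
      (Metric.infEDist_ne_top (Set.range_nonempty _))).2 hq
  obtain ⟨f, y, hf, hy, hfy⟩ := exists_interchanged_seq hz hq'
  refine hrq.trans_le ?_
  have h1 : ENNReal.ofReal (q / 2) ≤ setDist (clu 𝕜 y) (canonicalImage 𝕜 X) :=
    ofReal_le_setDist fun w hw p => by
      linarith [le_two_mul_norm_sub_of_interchanged hf hfy hw p]
  calc (q : ℝ≥0∞) = 2 * ENNReal.ofReal (q / 2) := by
        rw [← ENNReal.ofReal_ofNat 2, ← ENNReal.ofReal_mul zero_le_two, mul_div_cancel₀ _ two_ne_zero,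
          ENNReal.ofReal_coe_nnreal]
    _ ≤ 2 * wck 𝕜 (Set.range x) := by
        gcongr
        exact h1.trans (le_iSup₂ (f := fun (y : ℕ → X) (_ : ∀ n, y n ∈ Set.range x) =>
          setDist (clu 𝕜 y) (canonicalImage 𝕜 X)) y hy)

end Eberlein

/-- A sequence is built from a property of finite sets that can always be extended by a point. -/
theorem exists_seq_of_finset_insert {β : Type*} [DecidableEq β] {Good : Finset β → Prop}
    {Q : ℕ → Finset β → β → Prop} (h0 : Good ∅)
    (hstep : ∀ k C, Good C → ∃ b, Q k C b ∧ Good (insert b C)) :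
    ∃ s : ℕ → β, ∀ k, Q k ((Finset.range k).image s) (s k) ∧ Good ((Finset.range k).image s) := by
  choose b hbQ hbG using fun (k : ℕ) (C : {C // Good C}) => hstep k C.1 C.2
  let C : ℕ → {C // Good C} := fun k =>
    Nat.rec ⟨∅, h0⟩ (fun k D => ⟨insert (b k D) D.1, hbG k D⟩) k
  have hC : ∀ k, (C k).1 = (Finset.range k).image fun k => b k (C k) := by
    intro k
    induction k with
    | zero => rfl
    | succ k ih => rw [Finset.range_add_one, Finset.image_insert, ← ih]
  refine ⟨fun k => b k (C k), fun k => ?_⟩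
  rw [← hC]
  exact ⟨hbQ k (C k), (C k).2⟩

/-! ### Oscillation in `L`-embedded spaces. -/

section LEmbedded

variable {𝕜 : Type*} [RCLike 𝕜] {X : Type*} [NormedAddCommGroup X] [NormedSpace 𝕜 X]

/-- In the dual of an `L`-embedded space the values on finitely many points and on one singular
functional can be prescribed independently. -/
theorem exists_filter_prescribed {P : Bidual 𝕜 X →L[𝕜] Bidual 𝕜 X}
    (hP : IsLprojection (Bidual 𝕜 X) P) (hrange : Set.range P = canonicalImage 𝕜 X)
    {f : StrongDual 𝕜 X} (hf : ‖f‖ ≤ 1) (z : Bidual 𝕜 X) {σ : ℝ} (hσ : |σ| ≤ 1) :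
    ∃ l : Filter (StrongDual 𝕜 X), l.NeBot ∧ (∀ᶠ g in l, ‖g‖ ≤ 1) ∧
      (∀ p : X, Tendsto (fun g => g p) l (𝓝 (f p))) ∧
      Tendsto (fun g => (z - P z) g) l (𝓝 ((σ * ‖z - P z‖ : ℝ) : 𝕜)) := by
  have hidem : ∀ w, P (P w) = P w := fun w => DFunLike.congr_fun hP.proj.eq w
  have hPJ : ∀ p : X, P (NormedSpace.inclusionInDoubleDual 𝕜 X p) =
      NormedSpace.inclusionInDoubleDual 𝕜 X p := by
    intro p
    obtain ⟨w, hw⟩ := hrange.ge ⟨p, rfl⟩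
    rw [← hw, hidem]
  obtain ⟨ψ, hψ, hψz⟩ := exists_dual_vector'' 𝕜 (z - P z)
  -- `Φ` acts as `f` on the range of `P` and as `σ • ψ` on its kernel; additivity of the norm over
  -- the two parts keeps `‖Φ‖ ≤ 1`.
  let Φ : StrongDual 𝕜 (Bidual 𝕜 X) :=
    (NormedSpace.inclusionInDoubleDual 𝕜 (StrongDual 𝕜 X) f) ∘L P +
      ((σ : 𝕜) • ψ) ∘L (ContinuousLinearMap.id 𝕜 _ - P)
  have hΦv : ∀ w, Φ w = P w f + σ * ψ (w - P w) := fun w => rfl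
  have hΦ : ‖Φ‖ ≤ 1 := by
    refine ContinuousLinearMap.opNorm_le_bound _ zero_le_one fun w => ?_
    have hL : ‖w‖ = ‖P w‖ + ‖w - P w‖ := hP.Lnorm w
    rw [hΦv, one_mul, hL]
    refine (norm_add_le _ _).trans (add_le_add ((P w).unit_le_opNorm f hf) ?_)
    rw [norm_mul, RCLike.norm_ofReal]
    calc |σ| * ‖ψ (w - P w)‖ ≤ 1 * (1 * ‖w - P w‖) := by
          gcongr
          exact ψ.le_of_opNorm_le hψ _
      _ = ‖w - P w‖ := by ring
  obtain ⟨l, hl, hl1, hlim⟩ := exists_filter_tendsto_bidual Φ hΦ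
  refine ⟨l, hl, hl1, fun p => ?_, ?_⟩
  · have h := hlim (NormedSpace.inclusionInDoubleDual 𝕜 X p)
    rw [hΦv, hPJ, sub_self, map_zero, mul_zero, add_zero] at h
    exact h
  · have h := hlim (z - P z)
    have h0 : P (z - P z) = 0 := by rw [map_sub, hidem, sub_self]
    rw [hΦv, h0, sub_zero, hψz] at h
    simpa using h

/-- At each stage the functional is replaced by one that keeps the strict inequalities at the points
already chosen but takes a prescribed sign on `z - P z`; as this is a cluster point of `u`, a later
term realises that sign. A weak* limit retains all inequalities in weak form. -/
theorem exists_alternating_functional {P : Bidual 𝕜 X →L[𝕜] Bidual 𝕜 X}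
    (hP : IsLprojection (Bidual 𝕜 X) P) (hrange : Set.range P = canonicalImage 𝕜 X)
    {u : ℕ → X} {z : Bidual 𝕜 X} (hz : z - P z ∈ clu 𝕜 u) {r : ℝ} (hr : r < ‖z - P z‖) :
    ∃ f : StrongDual 𝕜 X, ‖f‖ ≤ 1 ∧ ∀ N, (∃ n ≥ N, r ≤ RCLike.re (f (u n))) ∧
      ∃ n ≥ N, RCLike.re (f (u n)) ≤ -r := by
  classical
  obtain ⟨U, hU, hUz⟩ := mem_clu_iff.1 hz
  let σ : Bool → ℝ := fun b => cond b 1 (-1)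
  have hσ : ∀ b, |σ b| ≤ 1 := by rintro (_ | _) <;> simp [σ]
  have hσ' : ∀ b t, σ b * (σ b * t) = t := by rintro (_ | _) t <;> simp [σ]
  obtain ⟨s, hs⟩ := exists_seq_of_finset_insert
    (Good := fun C : Finset (ℕ × Bool) => ∃ f : StrongDual 𝕜 X, ‖f‖ ≤ 1 ∧
      ∀ c ∈ C, r < σ c.2 * RCLike.re (f (u c.1)))
    (Q := fun k _ b => k ≤ b.1 ∧ b.2 = k.bodd) ⟨0, by simp, by simp⟩ (by
      rintro k C ⟨f, hf, hfC⟩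
      obtain ⟨l, _, hl1, hlp, hlz⟩ := exists_filter_prescribed hP hrange hf z (hσ k.bodd)
      have h1 : ∀ᶠ g in l, ∀ c ∈ C, r < σ c.2 * RCLike.re (g (u c.1)) := by
        refine (Finset.eventually_all C).2 fun c hc => ?_
        exact (((RCLike.continuous_re.tendsto _).comp (hlp (u c.1))).const_mul _).eventually_const_lt
          (hfC c hc)
      have h2 : ∀ᶠ g in l, r < σ k.bodd * RCLike.re ((z - P z) g) := by
        refine (((RCLike.continuous_re.tendsto _).comp hlz).const_mul _).eventually_const_lt ?_
        rwa [RCLike.ofReal_re, hσ']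
      obtain ⟨g, hg, hgC, hgz⟩ := (hl1.and (h1.and h2)).exists
      have h3 : ∀ᶠ n in (U : Filter ℕ), r < σ k.bodd * RCLike.re (g (u n)) :=
        (((RCLike.continuous_re.tendsto _).comp (hUz g)).const_mul _).eventually_const_lt hgz
      obtain ⟨n, hn, hkn⟩ := (h3.and (hU (eventually_ge_atTop k))).exists
      refine ⟨(n, k.bodd), ⟨hkn, rfl⟩, g, hg, fun c hc => ?_⟩
      obtain rfl | hc := Finset.mem_insert.1 hc
      exacts [hn, hgC c hc])
  choose g hg hgs using fun k => (hs k).2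
  let V : Ultrafilter ℕ := Ultrafilter.of atTop
  have hV : (V : Filter ℕ) ≤ atTop := Ultrafilter.of_le _
  obtain ⟨f, hf, hlim⟩ := exists_ultrafilter_limit V g hg
  have hfs : ∀ k, r ≤ σ k.bodd * RCLike.re (f (u (s k).1)) := by
    intro k
    refine ge_of_tendsto (((RCLike.continuous_re.tendsto _).comp (hlim (u (s k).1))).const_mul _) ?_
    filter_upwards [hV (eventually_gt_atTop k)] with m hm
    rw [← (hs k).1.2]
    exact (hgs m _ (Finset.mem_image_of_mem _ (Finset.mem_range.2 hm))).le
  -- `Nat.bodd` is true at odd indices, so these carry the sign `+` and even ones the sign `-`.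
  refine ⟨f, hf, fun N => ⟨⟨(s (2 * N + 1)).1, ?_, ?_⟩, ⟨(s (2 * N)).1, ?_, ?_⟩⟩⟩
  · have := (hs (2 * N + 1)).1.1
    omega
  · simpa [σ] using hfs (2 * N + 1)
  · have := (hs (2 * N)).1.1
    omega
  · have := hfs (2 * N)
    simp [σ] at this
    linarith

/-- Translation by `p = P z` moves the cluster point to `z - P z` and does not affect oscillations.
-/
theorem condI_half_of_lEmbedded (h : LEmbedded 𝕜 X) : CondI 𝕜 X (1 / 2) := by
  obtain ⟨P, hP, hrange⟩ := h
  intro x _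
  refine iSup₂_le fun z hz => ?_
  obtain ⟨p, hp⟩ := hrange.le ⟨z, rfl⟩
  have hdist : Metric.infEDist z (canonicalImage 𝕜 X) ≤ ENNReal.ofReal ‖z - P z‖ := by
    rw [← dist_eq_norm, ← edist_dist]
    exact Metric.infEDist_le_edist_of_mem (hrange.le ⟨z, rfl⟩)
  have hclu : z - P z ∈ clu 𝕜 fun n => x n - p := by
    obtain ⟨U, hU, hUz⟩ := mem_clu_iff.1 hz
    refine mem_clu_iff.2 ⟨U, hU, fun f => ?_⟩
    rw [← hp]
    simpa using (hUz f).sub_const (f p)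
  refine hdist.trans (le_of_forall_lt fun t ht => ?_)
  obtain ⟨r, htr, hr⟩ := ENNReal.lt_iff_exists_nnreal_btwn.1 ht
  have hr' : (r : ℝ) < ‖z - P z‖ :=
    (ENNReal.lt_ofReal_iff_toReal_lt ENNReal.coe_ne_top).1 hr
  refine htr.trans_le ?_
  obtain ⟨f, hf, hosc⟩ := exists_alternating_functional hP hrange hclu hr'
  have h2r : ((2 * r : ℝ≥0) : ℝ≥0∞) ≤ delta 𝕜 x := by
    refine le_trans ?_ (le_iSup₂ (f := fun (f : StrongDual 𝕜 X) (_ : f ∈ Metric.closedBall 0 1) =>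
      ca (fun n => f (x n))) f (by simpa using hf))
    refine le_iInf fun N => ?_
    obtain ⟨⟨m, hm, hfm⟩, n, hn, hfn⟩ := hosc N
    refine le_trans ?_ (Metric.edist_le_ediam_of_mem ⟨m, hm, rfl⟩ ⟨n, hn, rfl⟩)
    rw [edist_nndist, ENNReal.coe_le_coe, ← NNReal.coe_le_coe, coe_nndist, dist_eq_norm]
    refine le_trans ?_ (RCLike.re_le_norm _)
    simp only [map_sub] at hfm hfn ⊢
    push_cast
    linarith
  calc (r : ℝ≥0∞) = ((1 / 2 : ℝ≥0) : ℝ≥0∞) * ((2 * r : ℝ≥0) : ℝ≥0∞) := by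
        rw [← ENNReal.coe_mul]
        congr 1
        field_simp
    _ ≤ _ := by gcongr

end LEmbedded

/-! ### Rosenthal's combinatorial dichotomy. -/

section Independence

variable {T : Type*}

/-- Some point of `S` lies, for each `b`, in infinitely many of the sets `E b n` with `n ∈ L`. -/
def Oscillates (E : Bool → ℕ → Set T) (S : Set T) (L : Set ℕ) : Prop :=
  ∃ t ∈ S, ∀ b, {n ∈ L | t ∈ E b n}.Infinite

/-- Diagonal sequence of a decreasing sequence of infinite sets. -/
theorem exists_strictMono_diagonal {M : Set ℕ} (hM : M.Infinite) {Q : ℕ → ℕ → Set ℕ → Prop}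
    (h : ∀ k, ∀ n ∈ M, ∀ M' ⊆ M, M'.Infinite → ∃ L ⊆ M', L.Infinite ∧ Q k n L) :
    ∃ (ν : ℕ → ℕ) (L : ℕ → Set ℕ), StrictMono ν ∧ (∀ k, ν k ∈ M) ∧ (∀ k, Q k (ν k) (L k)) ∧
      ∀ k j, k < j → ν j ∈ L k := by
  have hmem : ∀ A : {A : Set ℕ // A ⊆ M ∧ A.Infinite}, sInf A.1 ∈ A.1 := fun A =>
    Nat.sInf_mem A.2.2.nonempty
  have hstep : ∀ (k : ℕ) (A : {A : Set ℕ // A ⊆ M ∧ A.Infinite}),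
      ∃ B : {A : Set ℕ // A ⊆ M ∧ A.Infinite}, B.1 ⊆ A.1 ∩ Set.Ioi (sInf A.1) ∧
        Q k (sInf A.1) B.1 := by
    intro k A
    have hsub : A.1 ∩ Set.Ioi (sInf A.1) ⊆ M := Set.inter_subset_left.trans A.2.1
    have hinf : (A.1 ∩ Set.Ioi (sInf A.1)).Infinite := by
      refine (A.2.2.sdiff (Set.finite_Iic (sInf A.1))).mono fun n hn => ⟨hn.1, ?_⟩
      simpa using hn.2
    obtain ⟨L, hL, hLinf, hQ⟩ := h k (sInf A.1) (A.2.1 (hmem A)) _ hsub hinf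
    exact ⟨⟨L, hL.trans hsub, hLinf⟩, hL, hQ⟩
  choose next hnext hQ using hstep
  let A : ℕ → {A : Set ℕ // A ⊆ M ∧ A.Infinite} := fun k =>
    Nat.rec ⟨M, subset_rfl, hM⟩ next k
  have hA : ∀ k, (A (k + 1)).1 ⊆ (A k).1 ∩ Set.Ioi (sInf (A k).1) := fun k => hnext k (A k)
  have hanti : Antitone fun k => (A k).1 :=
    antitone_nat_of_succ_le fun k => (hA k).trans Set.inter_subset_left
  refine ⟨fun k => sInf (A k).1, fun k => (A (k + 1)).1, strictMono_nat_of_lt_succ fun k => ?_,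
    fun k => (A k).2.1 (hmem _), fun k => hQ k (A k), fun k j hkj => hanti hkj (hmem _)⟩
  exact (hA k (hmem (A (k + 1)))).2

variable {E : Bool → ℕ → Set T}

theorem Oscillates.of_eventually_mem {S : Set T} {ν : ℕ → ℕ} {I L : Set ℕ} {k : ℕ}
    (h : Oscillates E S (ν '' I)) (hL : ∀ j, k < j → ν j ∈ L) : Oscillates E S L := by
  obtain ⟨t, ht, hosc⟩ := h
  refine ⟨t, ht, fun b => ((hosc b).sdiff ((Set.finite_Iic k).image ν)).mono ?_⟩
  rintro _ ⟨⟨⟨j, -, rfl⟩, hj⟩, hjk⟩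
  refine ⟨hL j ?_, hj⟩
  by_contra! hle
  exact hjk ⟨j, hle, rfl⟩

/-- If every choice of `n` and `M'` failed, a diagonal sequence `ν` would collect failures, and by
pigeonhole infinitely many share one `S₀` and `b₀`. A point of `S₀` oscillating along those indices
lies in `E b₀ (ν k)` for one of them, and the tail of `ν` lies in `L k`, contradicting the failure
there. -/
theorem exists_oscillates_inter {M : Set ℕ} (hM : M.Infinite) {𝒯 : Set (Set T)} (h𝒯 : 𝒯.Finite)
    (h : ∀ L ⊆ M, L.Infinite → ∀ S ∈ 𝒯, Oscillates E S L) :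
    ∃ n ∈ M, ∃ M' ⊆ M, M'.Infinite ∧
      ∀ L ⊆ M', L.Infinite → ∀ S ∈ 𝒯, ∀ b, Oscillates E (S ∩ E b n) L := by
  by_contra! hcon
  obtain ⟨ν, L, hν, hνM, hQ, hνL⟩ := exists_strictMono_diagonal hM
    (Q := fun _ n L => ∃ S ∈ 𝒯, ∃ b, ¬ Oscillates E (S ∩ E b n) L)
    (fun _ n hn M' hM' hinf => hcon n hn M' hM' hinf)
  choose S hS b hb using hQ
  have := h𝒯.to_subtype
  obtain ⟨⟨S₀, b₀⟩, hfib⟩ := Finite.exists_infinite_fiber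
    (fun k => ((⟨S k, hS k⟩, b k) : 𝒯 × Bool))
  let I : Set ℕ := (fun k => ((⟨S k, hS k⟩, b k) : 𝒯 × Bool)) ⁻¹' {(S₀, b₀)}
  have hI : I.Infinite := Set.infinite_coe_iff.1 hfib
  have hosc := h (ν '' I) (by rintro _ ⟨k, -, rfl⟩; exact hνM k)
    (hI.image hν.injective.injOn) S₀ S₀.2
  obtain ⟨t, ht, hinf⟩ := hosc
  obtain ⟨_, ⟨k, hk, rfl⟩, htk⟩ := (hinf b₀).nonempty
  have hk' : S k = S₀ ∧ b k = b₀ := by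
    have := Prod.ext_iff.1 (Set.mem_singleton_iff.1 hk)
    exact ⟨congrArg Subtype.val this.1, this.2⟩
  refine hb k (Oscillates.of_eventually_mem (ν := ν) (I := I) ⟨t, ⟨?_, ?_⟩, hinf⟩ (hνL k))
  · rw [hk'.1]; exact ht
  · rw [hk'.2]; exact htk

/-- Rosenthal's dichotomy: if every subsequence of the pairs `E true n`, `E false n` oscillates at
some point, there is an independent subsequence. -/
theorem exists_independent_subseq {B : Set T} {M : Set ℕ} (hM : M.Infinite)
    (h : ∀ L ⊆ M, L.Infinite → Oscillates E B L) :
    ∃ s : ℕ → ℕ, ∀ (K : ℕ) (ε : ℕ → Bool), ∃ t ∈ B, ∀ k < K, t ∈ E (ε k) (s k) := by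
  classical
  obtain ⟨s, hs⟩ := exists_seq_of_finset_insert
    (Good := fun C : Finset ℕ => ∃ M : Set ℕ, M.Infinite ∧ ∀ L ⊆ M, L.Infinite →
      ∀ ε : ℕ → Bool, Oscillates E (B ∩ ⋂ n ∈ C, E (ε n) n) L)
    (Q := fun _ C n => n ∉ C) ⟨M, hM, fun L hL hinf ε => by simpa using h L hL hinf⟩ (by
      rintro - C ⟨M, hM, hC⟩
      obtain ⟨n, hn, M', hM', hinf, hosc⟩ := exists_oscillates_inter (E := E)
        (M := M \ C) (hM.sdiff C.finite_toSet)
        (𝒯 := Set.range fun ε : ℕ → Bool => B ∩ ⋂ n ∈ C, E (ε n) n)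
        ((Set.finite_range fun η : C → Bool => B ∩ ⋂ n : C, E (η n) n.1).subset (by
          rintro _ ⟨ε, rfl⟩
          exact ⟨fun n => ε n, by simp only [Set.iInter_subtype]⟩))
        (by
          rintro L hL hinf _ ⟨ε, rfl⟩
          exact hC L (hL.trans Set.sdiff_subset) hinf ε)
      refine ⟨n, fun h => hn.2 (Finset.mem_coe.2 h), M', hinf, fun L hL hLinf ε => ?_⟩
      have := hosc L hL hLinf _ ⟨ε, rfl⟩ (ε n)
      rwa [Set.inter_assoc, Set.inter_comm _ (E (ε n) n), ← Finset.set_biInter_insert n C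
        fun n => E (ε n) n] at this)
  have hlt : ∀ i j, i < j → s i ≠ s j := fun i j hij heq =>
    (hs j).1 (heq ▸ Finset.mem_image_of_mem s (Finset.mem_range.2 hij))
  have hinj : Function.Injective s := fun i j hij => by
    by_contra hne
    exact (lt_or_gt_of_ne hne).elim (fun h => hlt i j h hij) fun h => hlt j i h hij.symm
  refine ⟨s, fun K ε => ?_⟩
  obtain ⟨M, hM, hosc⟩ := (hs K).2
  -- The signs are indexed by values of `s`; injectivity of `s` permits reindexing them by position.
  obtain ⟨t, ht, -⟩ := hosc M subset_rfl hM (ε ∘ Function.invFun s)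
  refine ⟨t, ht.1, fun k hk => ?_⟩
  have := Set.mem_iInter₂.1 ht.2 (s k) (Finset.mem_image_of_mem s (Finset.mem_range.2 hk))
  rwa [Function.comp_apply, Function.leftInverse_invFun hinj k] at this

end Independence

/-! ### Level sets in the dual ball. -/

section LevelSets

variable {𝕜 : Type*} [RCLike 𝕜] {X : Type*} [NormedAddCommGroup X] [NormedSpace 𝕜 X]

/-- The functionals whose real part at `x n` is at least `b`, or at most `a`. -/
def levelSets (𝕜 : Type*) [RCLike 𝕜] {X : Type*} [NormedAddCommGroup X] [NormedSpace 𝕜 X]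
    (x : ℕ → X) (a b : ℝ) (c : Bool) (n : ℕ) : Set (WeakDual 𝕜 X) :=
  cond c {f | b ≤ RCLike.re (f (x n))} {f | RCLike.re (f (x n)) ≤ a}

/-- The closed unit ball of the dual, in the weak* topology. -/
def dualBall (𝕜 : Type*) [RCLike 𝕜] (X : Type*) [NormedAddCommGroup X] [NormedSpace 𝕜 X] :
    Set (WeakDual 𝕜 X) :=
  WeakDual.toStrongDual ⁻¹' Metric.closedBall 0 1

theorem isClosed_levelSets (x : ℕ → X) (a b : ℝ) (c : Bool) (n : ℕ) :
    IsClosed (levelSets 𝕜 x a b c n) := by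
  have hcont : Continuous fun f : WeakDual 𝕜 X => RCLike.re (f (x n)) :=
    RCLike.continuous_re.comp (WeakDual.eval_continuous (x n))
  cases c
  exacts [isClosed_le hcont continuous_const, isClosed_le continuous_const hcont]

/-- Otherwise each gap could be destroyed on a further infinite set. Diagonalising over the
countably many rational gaps gives a subsequence on which none larger than `d` survives, although
its oscillation still exceeds `d`. -/
theorem exists_oscillates_levelSets {x : ℕ → X} (hx : Bornology.IsBounded (Set.range x)) {d : ℝ≥0}
    (hd : d < deltaTilde 𝕜 x) :
    ∃ a b : ℝ, (d : ℝ) < b - a ∧ ∃ M : Set ℕ, M.Infinite ∧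
      ∀ L ⊆ M, L.Infinite → Oscillates (levelSets 𝕜 x a b) (dualBall 𝕜 X) L := by
  by_contra! hcon
  obtain ⟨q, hq⟩ := exists_surjective_nat (ℚ × ℚ)
  obtain ⟨ν, L, hν, -, hQ, hνL⟩ := exists_strictMono_diagonal Set.infinite_univ
    (Q := fun k _ L => (d : ℝ) < (q k).2 - (q k).1 →
      ¬ Oscillates (levelSets 𝕜 x (q k).1 (q k).2) (dualBall 𝕜 X) L) (by
      intro k _ _ M' _ hM'
      by_cases hdq : (d : ℝ) < (q k).2 - (q k).1
      · obtain ⟨L, hL, hinf, hosc⟩ := hcon _ _ hdq M' hM'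
        exact ⟨L, hL, hinf, fun _ => hosc⟩
      · exact ⟨M', subset_rfl, hM', fun h => (hdq h).elim⟩)
  obtain ⟨f, hf, a, b, hab, ha, hb⟩ := exists_re_oscillation (𝕜 := 𝕜) (x := x ∘ ν)
    (hx.subset (Set.range_comp_subset_range ν x))
    (hd.trans_le (deltaTilde_le_delta_comp x hν))
  obtain ⟨k, hk⟩ := hq (a, b)
  have hQk := hQ k
  rw [hk] at hQk
  refine hQk hab (Oscillates.of_eventually_mem (ν := ν) (I := Set.univ) (k := k)
    ⟨StrongDual.toWeakDual f, by simpa [dualBall] using hf, ?_⟩ (hνL k))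
  have himage : ∀ p : ℕ → Prop, (∃ᶠ n in atTop, p (ν n)) →
      {n ∈ ν '' Set.univ | p n}.Infinite := fun p hp =>
    ((Nat.frequently_atTop_iff_infinite.1 hp).image hν.injective.injOn).mono (by
      rintro _ ⟨n, hn, rfl⟩
      exact ⟨⟨n, trivial, rfl⟩, hn⟩)
  rintro (_ | _)
  exacts [himage _ ha, himage _ hb]

end LevelSets

/-! ### Irreducible restrictions of continuous surjections. -/

section Irreducible

universe u

/-- A continuous surjection of a compact space is irreducible on some nonempty set: closed sets
containing densely many full fibres contain this set. -/
theorem exists_nonempty_subset_of_dense_fibres {D : Type u} {A : Type} [TopologicalSpace D]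
    [CompactSpace D] [TopologicalSpace A] [T2Space A] [Nonempty A] {π : D → A} (hπ : Continuous π)
    (hsurj : Function.Surjective π) :
    ∃ K : Set D, K.Nonempty ∧ ∀ W : Set D, IsClosed W →
      Dense {a | ∀ q, π q = a → q ∈ W} → K ⊆ W := by
  have hπ' : Continuous fun q => (ULift.up (π q) : ULift.{u} A) := continuous_uliftUp.comp hπ
  obtain ⟨K, hK, himage, hmin⟩ := exists_compact_surjective_zorn_subset hπ'
    (ULift.up_surjective.comp hsurj)
  refine ⟨K, ?_, fun W hW hdense => ?_⟩
  · exact Set.image_nonempty.1 (himage ▸ Set.univ_nonempty)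
  · let W₀ : Set K := Subtype.val ⁻¹' W
    have hW₀ : IsClosed W₀ := hW.preimage continuous_subtype_val
    by_contra hnot
    have hne : W₀ ≠ Set.univ := fun h => hnot fun q hq => h.ge (Set.mem_univ (⟨q, hq⟩ : K))
    refine hmin W₀ hne hW₀ ?_
    -- The image of `W₀` is compact and contains a dense set, hence is everything, against
    -- minimality of `K`.
    have hcl : IsClosed (K.domRestrict (fun q => (ULift.up (π q) : ULift.{u} A)) '' W₀) :=
      (hW₀.isCompact.image (hπ'.comp continuous_subtype_val)).isClosed
    rw [← hcl.closure_eq]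
    refine ((hdense.preimage Homeomorph.ulift.isOpenMap).mono fun a ha => ?_).closure_eq
    obtain ⟨q, hq, rfl⟩ := himage.ge (Set.mem_univ a)
    exact ⟨⟨q, hq⟩, ha q rfl, rfl⟩

theorem dense_eventually_eq (b : Bool) : Dense {ε : ℕ → Bool | ∀ᶠ n in atTop, ε n = b} := by
  intro ε
  refine mem_closure_of_tendsto (b := atTop) (f := fun k n => if n < k then ε n else b) ?_ ?_
  · refine tendsto_pi_nhds.2 fun n => tendsto_const_nhds.congr' ?_
    filter_upwards [eventually_gt_atTop n] with k hk
    rw [if_pos hk]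
  · refine Eventually.of_forall fun k => ?_
    filter_upwards [eventually_ge_atTop k] with n hn
    rw [if_neg hn.not_gt]

end Irreducible

/-! ### Comparison of the quantities and conditions. -/

section Comparison

variable {𝕜 : Type*} [RCLike 𝕜] {X : Type*} [NormedAddCommGroup X] [NormedSpace 𝕜 X]

/-- Cluster points of a sequence with independent level sets are far from `X`. -/
theorem sub_le_two_mul_norm_of_independent {y : ℕ → X} {a b : ℝ}
    (hy : ∀ (K : ℕ) (ε : ℕ → Bool), ∃ t ∈ dualBall 𝕜 X, ∀ k < K, t ∈ levelSets 𝕜 y a b (ε k) k)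
    {w : Bidual 𝕜 X} (hw : w ∈ clu 𝕜 y) (p : X) :
    b - a ≤ 2 * ‖w - NormedSpace.inclusionInDoubleDual 𝕜 X p‖ := by
  set σ : ℝ := ‖w - NormedSpace.inclusionInDoubleDual 𝕜 X p‖
  have hB : IsCompact (dualBall 𝕜 X) := WeakDual.isCompact_closedBall 0 1
  -- The sign sequence is stored alongside the functional, so that the projection to the Cantor
  -- space is continuous; independence and compactness make it surjective.
  let D : Set (WeakDual 𝕜 X × (ℕ → Bool)) :=
    {q | q.1 ∈ dualBall 𝕜 X ∧ ∀ k, q.1 ∈ levelSets 𝕜 y a b (q.2 k) k}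
  have hDclosed : IsClosed {q : WeakDual 𝕜 X × (ℕ → Bool) |
      ∀ k, q.1 ∈ levelSets 𝕜 y a b (q.2 k) k} := by
    simp only [Set.ofPred_forall]
    refine isClosed_iInter fun k => ?_
    have : {q : WeakDual 𝕜 X × (ℕ → Bool) | q.1 ∈ levelSets 𝕜 y a b (q.2 k) k} =
        ⋃ c : Bool, (fun q : WeakDual 𝕜 X × (ℕ → Bool) => q.2 k) ⁻¹' {c} ∩
          Prod.fst ⁻¹' levelSets 𝕜 y a b c k := by
      ext q
      simp
    rw [this]
    exact isClosed_iUnion_of_finite fun c =>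
      ((isClosed_discrete {c}).preimage ((continuous_apply k).comp continuous_snd)).inter
        ((isClosed_levelSets y a b c k).preimage continuous_fst)
  have hD : IsCompact D := by
    have : D = (dualBall 𝕜 X ×ˢ Set.univ) ∩
        {q : WeakDual 𝕜 X × (ℕ → Bool) | ∀ k, q.1 ∈ levelSets 𝕜 y a b (q.2 k) k} := by
      ext q
      simp [D]
    rw [this]
    exact (hB.prod isCompact_univ).inter_right hDclosed
  have : CompactSpace D := isCompact_iff_compactSpace.1 hD
  have hsurj : Function.Surjective fun q : D => q.1.2 := by
    intro ε
    have hcl : ∀ K, IsClosed (⋂ k < K, levelSets 𝕜 y a b (ε k) k) := fun K =>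
      isClosed_biInter fun k _ => isClosed_levelSets y a b (ε k) k
    obtain ⟨t, ht⟩ := IsCompact.nonempty_iInter_of_sequence_nonempty_isCompact_isClosed
      (fun K => dualBall 𝕜 X ∩ ⋂ k < K, levelSets 𝕜 y a b (ε k) k)
      (fun K => Set.inter_subset_inter_right _
        (Set.biInter_subset_biInter_left fun k hk => lt_trans hk K.lt_succ_self))
      (fun K => (hy K ε).imp fun t ht => ⟨ht.1, Set.mem_iInter₂.2 ht.2⟩)
      (hB.inter_right (hcl 0)) (fun K => hB.isClosed.inter (hcl K))
    rw [Set.mem_iInter] at ht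
    exact ⟨⟨(t, ε), (ht 0).1, fun k => Set.mem_iInter₂.1 (ht (k + 1)).2 k k.lt_succ_self⟩, rfl⟩
  obtain ⟨K, ⟨q, hq⟩, hK⟩ := exists_nonempty_subset_of_dense_fibres
    (continuous_snd.comp continuous_subtype_val) hsurj
  obtain ⟨V, hV, hVw⟩ := mem_clu_iff.1 hw
  have hcont : Continuous fun q : D => RCLike.re (q.1.1 p) :=
    RCLike.continuous_re.comp ((WeakDual.eval_continuous p).comp
      (continuous_fst.comp continuous_subtype_val))
  have hnear : ∀ t ∈ dualBall 𝕜 X,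
      |RCLike.re (w (WeakDual.toStrongDual t)) - RCLike.re (t p)| ≤ σ := by
    intro t ht
    have h := (w - NormedSpace.inclusionInDoubleDual 𝕜 X p).unit_le_opNorm
      (WeakDual.toStrongDual t) (by simpa [dualBall] using ht)
    refine le_trans ?_ h
    have := RCLike.abs_re_le_norm ((w - NormedSpace.inclusionInDoubleDual 𝕜 X p)
      (WeakDual.toStrongDual t))
    rwa [sub_apply, NormedSpace.dual_def, map_sub] at this
  have hlim : ∀ t : WeakDual 𝕜 X, Tendsto (fun n => RCLike.re (t (y n))) V
      (𝓝 (RCLike.re (w (WeakDual.toStrongDual t)))) := fun t =>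
    (RCLike.continuous_re.tendsto _).comp (hVw (WeakDual.toStrongDual t))
  -- Over a sign sequence that is eventually true, `w` has real part at least `b`, so the value at
  -- `p` has real part at least `b - σ`. Such sequences are dense, so the bound holds on all of `K`;
  -- eventually false ones give the opposite bound at the same `q`.
  have hlow : q ∈ {q : D | b - σ ≤ RCLike.re (q.1.1 p)} := by
    refine hK _ (isClosed_le continuous_const hcont) ((dense_eventually_eq true).mono ?_) hq
    rintro _ hε q rfl
    have hb : b ≤ RCLike.re (w (WeakDual.toStrongDual q.1.1)) := by
      refine ge_of_tendsto (hlim q.1.1) ?_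
      filter_upwards [hV hε] with n hn
      have := q.2.2 n
      rwa [show q.1.2 n = true from hn] at this
    have := abs_le.1 (hnear _ q.2.1)
    exact Set.mem_ofPred.2 (by linarith)
  have hhigh : q ∈ {q : D | RCLike.re (q.1.1 p) ≤ a + σ} := by
    refine hK _ (isClosed_le hcont continuous_const) ((dense_eventually_eq false).mono ?_) hq
    rintro _ hε q rfl
    have ha : RCLike.re (w (WeakDual.toStrongDual q.1.1)) ≤ a := by
      refine le_of_tendsto (hlim q.1.1) ?_
      filter_upwards [hV hε] with n hn
      have := q.2.2 n
      rwa [show q.1.2 n = false from hn] at this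
    have := abs_le.1 (hnear _ q.2.1)
    exact Set.mem_ofPred.2 (by linarith)
  have h1 : b - σ ≤ RCLike.re (q.1.1 p) := hlow
  have h2 : RCLike.re (q.1.1 p) ≤ a + σ := hhigh
  linarith

/-- The indices `s` need not increase: `wck` only asks for a sequence with terms in `A`. -/
theorem betaW_le_two_mul_wck {A : Set X} (hA : Bornology.IsBounded A) :
    betaW 𝕜 A ≤ 2 * wck 𝕜 A := by
  refine iSup₂_le fun x hx => le_of_forall_lt fun t ht => ?_
  obtain ⟨d, htd, hd⟩ := ENNReal.lt_iff_exists_nnreal_btwn.1 ht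
  obtain ⟨a, b, hab, M, hM, hosc⟩ := exists_oscillates_levelSets
    (hA.subset (Set.range_subset_iff.2 hx)) hd
  obtain ⟨s, hs⟩ := exists_independent_subseq hM hosc
  have h1 : ENNReal.ofReal (d / 2) ≤ setDist (clu 𝕜 (x ∘ s)) (canonicalImage 𝕜 X) :=
    ofReal_le_setDist fun w hw p => by
      have := sub_le_two_mul_norm_of_independent (y := x ∘ s) hs hw p
      linarith
  refine htd.trans_le ?_
  calc (d : ℝ≥0∞) = 2 * ENNReal.ofReal (d / 2) := by
        rw [← ENNReal.ofReal_ofNat 2, ← ENNReal.ofReal_mul zero_le_two, mul_div_cancel₀ _ two_ne_zero,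
          ENNReal.ofReal_coe_nnreal]
    _ ≤ 2 * wck 𝕜 A := by
        gcongr
        exact h1.trans (le_iSup₂ (f := fun (y : ℕ → X) (_ : ∀ n, y n ∈ A) =>
          setDist (clu 𝕜 y) (canonicalImage 𝕜 X)) (x ∘ s) fun n => hx (s n))

theorem CondI.condII {c : ℝ≥0} (h : CondI 𝕜 X c) : CondII 𝕜 X c := fun x hx =>
  (setDist_le_excess (clu_nonempty hx)).trans (h x hx)

theorem CondII.condIII {c : ℝ≥0} (hc : 0 < c) (h : CondII 𝕜 X c) : CondIII 𝕜 X c := by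
  intro x hx
  rw [deltaTilde, ENNReal.mul_iInf_of_ne (by exact_mod_cast hc.ne') ENNReal.coe_ne_top]
  refine le_iInf fun φ => ?_
  rw [ENNReal.mul_iInf_of_ne (by exact_mod_cast hc.ne') ENNReal.coe_ne_top]
  exact le_iInf fun hφ => (setDist_anti (clu_comp_subset hφ)).trans
    (h _ (hx.subset (Set.range_comp_subset_range φ x)))

theorem CondIII.condII {c : ℝ≥0} (h : CondIII 𝕜 X c) : CondII 𝕜 X c := fun x hx =>
  (h x hx).trans (by gcongr; exact deltaTilde_le_delta x)

theorem CondIII.condIV {c : ℝ≥0} (h : CondIII 𝕜 X c) : CondIV 𝕜 X c := fun A hA =>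
  iSup₂_le fun x hx => (h x (hA.subset (Set.range_subset_iff.2 hx))).trans (by
    gcongr
    exact le_iSup₂ (f := fun (x : ℕ → X) (_ : ∀ n, x n ∈ A) => deltaTilde 𝕜 x) x hx)

theorem CondIV.wck_range_le {c : ℝ≥0} (h : CondIV 𝕜 X c) {x : ℕ → X}
    (hx : Bornology.IsBounded (Set.range x)) : wck 𝕜 (Set.range x) ≤ c * delta 𝕜 x :=
  (h _ hx).trans (by gcongr; exact betaW_range_le_delta x)

theorem CondIV.condII {c : ℝ≥0} (h : CondIV 𝕜 X c) : CondII 𝕜 X c := fun x hx =>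
  (le_iSup₂ (f := fun (y : ℕ → X) (_ : ∀ n, y n ∈ Set.range x) =>
    setDist (clu 𝕜 y) (canonicalImage 𝕜 X)) x fun n => ⟨n, rfl⟩).trans (h.wck_range_le hx)

theorem CondIV.condI_two_mul [CompleteSpace X] {c : ℝ≥0} (h : CondIV 𝕜 X c) :
    CondI 𝕜 X (2 * c) := fun x hx => by
  rw [ENNReal.coe_mul, ENNReal.coe_ofNat, mul_assoc]
  exact (excess_clu_le_two_mul_wck x).trans (by gcongr; exact h.wck_range_le hx)

theorem CondI.condIV {c : ℝ≥0} (hc : 0 < c) (h : CondI 𝕜 X c) : CondIV 𝕜 X c :=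
  (h.condII.condIII hc).condIV

theorem CondI.mono {c c' : ℝ≥0} (hcc' : c ≤ c') (h : CondI 𝕜 X c) : CondI 𝕜 X c' := fun x hx =>
  (h x hx).trans (by gcongr)

end Comparison

end QuantWSC

theorem propositionP {𝕜 : Type*} [RCLike 𝕜] {X : Type*} [NormedAddCommGroup X]
    [NormedSpace 𝕜 X] [CompleteSpace X] :
    (∀ c : ℝ≥0, 0 < c →
      (QuantWSC.CondI 𝕜 X c → QuantWSC.CondII 𝕜 X c) ∧
      (QuantWSC.CondII 𝕜 X c ↔ QuantWSC.CondIII 𝕜 X c) ∧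
      (QuantWSC.CondIII 𝕜 X c ↔ QuantWSC.CondIV 𝕜 X c) ∧
      (QuantWSC.CondIV 𝕜 X c → QuantWSC.CondI 𝕜 X (2 * c))) ∧
    (QuantWSC.WckEquivBetaW 𝕜 X ↔ QuantWSC.QuantitativelyWSC 𝕜 X) ∧
    (QuantWSC.LEmbedded 𝕜 X →
      ∀ A : Set X, Bornology.IsBounded A → QuantWSC.betaW 𝕜 A = 2 * QuantWSC.wck 𝕜 A) := by
  refine ⟨fun c hc => ⟨fun h => h.condII, ⟨fun h => h.condIII hc, fun h => h.condII⟩,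
    ⟨fun h => h.condIV, fun h => h.condII.condIII hc⟩, fun h => h.condI_two_mul⟩, ⟨?_, ?_⟩, ?_⟩
  · rintro ⟨a, b, -, -, h⟩
    exact ⟨2 * a, QuantWSC.CondIV.condI_two_mul fun A hA => (h A hA).1⟩
  · rintro ⟨c, h⟩
    -- The given `c` may be 0, while the passage to (iv) requires a positive constant.
    have hc : 0 < c + 1 := by positivity
    exact ⟨c + 1, 2, hc, two_pos, fun A hA =>
      ⟨(h.mono le_self_add).condIV hc A hA, QuantWSC.betaW_le_two_mul_wck hA⟩⟩
  · intro hL A hA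
    refine le_antisymm (QuantWSC.betaW_le_two_mul_wck hA) ?_
    have h := (QuantWSC.condI_half_of_lEmbedded hL).condIV (by norm_num) A hA
    calc 2 * QuantWSC.wck 𝕜 A ≤ 2 * (((1 / 2 : ℝ≥0) : ℝ≥0∞) * QuantWSC.betaW 𝕜 A) := by gcongr
      _ = ((2 * (1 / 2) : ℝ≥0) : ℝ≥0∞) * QuantWSC.betaW 𝕜 A := by
          rw [ENNReal.coe_mul, ENNReal.coe_ofNat, mul_assoc]
      _ = QuantWSC.betaW 𝕜 A := by
          rw [mul_one_div_cancel two_ne_zero, ENNReal.coe_one, one_mul]
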